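/- Let $S$ and $E$ be finite-dimensional quantum systems of dimensions $d_S, d_E$, and put $d = d_S d_E$. For a state (density matrix) $\rho$ let $S(\rho) = -\mathrm{Tr}[\rho\ln\rho]$ be its von Neumann entropy and $C(\rho) = \mathrm{Tr}[\rho(\ln\rho)^2] - S(\rho)^2$ the variance of its modular Hamiltonian $-\ln\rho$ (with the convention $0\ln 0 = 0$), and let $S(\rho\|\sigma) = \mathrm{Tr}[\rho(\ln\rho-\ln\sigma)]$ be the relative entropy. A channel is a map $X\mapsto\sum_i K_i X K_i^\dagger$ with $\sum_i K_i^\dagger K_i = \mathbb 1$; it is unital if it maps $\mathbb 1$ to $\mathbb 1$. Let $\rho_S$ and $\rho_E$ be states of $S$ and $E$, let $\mathcal U$ be a unital channel on $S\otimes E$, and let $\mathcal E$ be a channel on $S$ with $\mathcal E(\rho_S) = \mathrm{Tr}_E[\mathcal U(\rho_S\otimes\rho_E)]$. Put $\rho'_{SE} = \mathcal U(\rho_S\otimes\rho_E)$, $\rho'_S = \mathrm{Tr}_E\,\rho'_{SE} = \mathcal E(\rho_S)$, $\rho'_E = \mathrm{Tr}_S\,\rho'_{SE}$, and, for $X\in\{S,E\}$,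 $\Delta S_X = S(\rho'_X) - S(\rho_X)$ and $\Delta C_X = C(\rho'_X) - C(\rho_X)$. Let $I_{SE} = S(\rho'_{SE}\,\|\,\rho'_S\otimes\rho'_E)$ be the mutual information of the final state, and let $$f(x) = \max\{x^{1/4}, x^{1/2}\},\qquad \kappa = \sqrt{2\ln 2}\,\bigl(12\ln^2 2 + 9\ln^2 d\bigr).$$ Then $$\Delta S_S + \Delta S_E \;\ge\; \bigl(S(\rho_S)+S(\rho_E)+1\bigr)\left\{\left[1 + \frac{-\Delta C_S-\Delta C_E-\kappa\, f(I_{SE}/\ln 2)}{\bigl(S(\rho_S)+S(\rho_E)+1\bigr)^2}\right]^{1/2} - 1\right\},$$ where the square root is read as $0$ if the expression in square brackets is negative. -/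

import Mathlib

open scoped Kronecker Matrix ComplexOrder

namespace QInfo

noncomputable section

/-- A quantum state of a finite-dimensional system: a density matrix, positive semidefinite of
trace one. -/
def IsState {n : Type*} [Fintype n] (ρ : Matrix n n ℂ) : Prop :=
  ρ.PosSemidef ∧ ρ.trace = 1

/-- A quantum channel of a finite-dimensional system to itself, in operator-sum (Kraus) form:
`X ↦ ∑ i, K i * X * (K i)ᴴ` with `∑ i, (K i)ᴴ * K i = 1`. -/
def IsChannel {n : Type*} [Fintype n] [DecidableEq n]
    (Φ : Matrix n n ℂ →ₗ[ℂ] Matrix n n ℂ) : Prop :=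
  ∃ (r : ℕ) (K : Fin r → Matrix n n ℂ),
    ∑ i, (K i)ᴴ * K i = 1 ∧ ∀ X, Φ X = ∑ i, K i * X * (K i)ᴴ

/-- A unital channel: a quantum channel that fixes the unit matrix. -/
def IsUnitalChannel {n : Type*} [Fintype n] [DecidableEq n]
    (Φ : Matrix n n ℂ →ₗ[ℂ] Matrix n n ℂ) : Prop :=
  IsChannel Φ ∧ Φ 1 = 1

/-- Partial trace over the second tensor factor. -/
def traceSnd {s e : Type*} [Fintype e] (X : Matrix (s × e) (s × e) ℂ) : Matrix s s ℂ :=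
  Matrix.of fun i j => ∑ k, X (i, k) (j, k)

/-- Partial trace over the first tensor factor. -/
def traceFst {s e : Type*} [Fintype s] (X : Matrix (s × e) (s × e) ℂ) : Matrix e e ℂ :=
  Matrix.of fun i j => ∑ k, X (k, i) (k, j)

/-- The (natural) logarithm of a positive semidefinite matrix, by functional calculus. On the
kernel it is set to `0` (as `Real.log 0 = 0`), which realizes the convention `0 ln 0 = 0` in the
traces `Tr [ρ (ln ρ) ^ k]` below. -/
def logm {n : Type*} [Fintype n] [DecidableEq n] (ρ : Matrix n n ℂ) : Matrix n n ℂ :=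
  cfc Real.log ρ

/-- Von Neumann entropy `S(ρ) = - Tr [ρ ln ρ]`. -/
def entropy {n : Type*} [Fintype n] [DecidableEq n] (ρ : Matrix n n ℂ) : ℝ :=
  -(ρ * logm ρ).trace.re

/-- Variance of the modular Hamiltonian `K = - ln ρ` (capacity of entanglement):
`C(ρ) = Tr [ρ (ln ρ)²] - S(ρ)²`. -/
def capacity {n : Type*} [Fintype n] [DecidableEq n] (ρ : Matrix n n ℂ) : ℝ :=
  (ρ * logm ρ ^ 2).trace.re - entropy ρ ^ 2

/-- Relative entropy `S(ρ ‖ σ) = Tr [ρ (ln ρ - ln σ)]`, for states such that the support of `ρ`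
lies in that of `σ`; it is used below only for such pairs. -/
def relEntropy {n : Type*} [Fintype n] [DecidableEq n] (ρ σ : Matrix n n ℂ) : ℝ :=
  (ρ * (logm ρ - logm σ)).trace.re

/-- Mutual information `S(ρ_SE ‖ ρ_S ⊗ ρ_E)` of a bipartite state. The support of a bipartite
state always lies in that of the product of its marginals. -/
def mutualInfo {s e : Type*} [Fintype s] [DecidableEq s] [Fintype e] [DecidableEq e]
    (ρ : Matrix (s × e) (s × e) ℂ) : ℝ :=
  relEntropy ρ (traceSnd ρ ⊗ₖ traceFst ρ)

/-- `f(x) = max {x^{1/4}, x^{1/2}}`. -/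
def corrFun (x : ℝ) : ℝ := max (x ^ (1 / 4 : ℝ)) (x ^ (1 / 2 : ℝ))

/-- The constant `κ = √(2 ln 2) (12 ln² 2 + 9 ln² d)` for total dimension `d`. -/
def corrConst (d : ℕ) : ℝ :=
  Real.sqrt (2 * Real.log 2) * (12 * Real.log 2 ^ 2 + 9 * Real.log (d : ℝ) ^ 2)

end

end QInfo

namespace QInfo

/-! Write `g(x) = x (1 - ln x)²`. Then `Tr g(ρ) = C(ρ) + (S(ρ) + 1)²`, and `g` is concave on `[0,
1]` (`surprisalSq_le_tangent`). Measure the final state in the product of the eigenbases of its two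
marginals. The unital channel followed by this measurement acts on the initial spectrum as a doubly
stochastic matrix (`IsUnitalChannel.sum_le_sum`), so the outcome distribution `p` has `∑ g(p)` at
least the initial `Tr g`.

The marginals `a`, `b` of `p` are the spectra of the final marginals. In the tangent bound for `g`
at `ab`, all first-order terms cancel except `2 ∑ (p - ab) ln a ln b`. Cauchy-Schwarz bounds this
covariance by the Hellinger distance and fourth log-moments; the squared distance is at most the
classical, hence the quantum, mutual information (`sum_sub_mul_log_mul_log_le`). Entropy and
capacity add over products, so the final `(S_S + S_E + 1)²` is bounded below, and a square root
finishes. -/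

/-- The concave function `x (1 - ln x)²`, whose trace is `C + (S + 1)²`. -/
noncomputable def surprisalSq (x : ℝ) : ℝ := x * (1 - Real.log x) ^ 2

@[simp] lemma surprisalSq_zero : surprisalSq 0 = 0 := by simp [surprisalSq]

/-! ### Scalar tangent inequalities -/

lemma two_sub_sq_le {t : ℝ} (ht : 0 ≤ t) : 2 - t ^ 2 ≤ (2 + 2 * t) * Real.exp (-t) := by
  have hd : ∀ x : ℝ, HasDerivAt (fun t : ℝ => (2 + 2 * t) * Real.exp (-t) - 2 + t ^ 2)
      (2 * x * (1 - Real.exp (-x))) x := by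
    intro x
    have h1 : HasDerivAt (fun t : ℝ => 2 + 2 * t) 2 x := by
      simpa using ((hasDerivAt_id x).const_mul 2).const_add 2
    have h2 : HasDerivAt (fun t : ℝ => Real.exp (-t)) (-Real.exp (-x)) x := by
      simpa using (hasDerivAt_neg x).exp
    refine (((h1.mul h2).sub_const 2).add (hasDerivAt_pow 2 x)).congr_deriv ?_
    push_cast
    ring
  have hm : MonotoneOn (fun t : ℝ => (2 + 2 * t) * Real.exp (-t) - 2 + t ^ 2) (Set.Ici 0) := by
    refine monotoneOn_of_deriv_nonneg (convex_Ici 0)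
      (fun x _ => (hd x).continuousAt.continuousWithinAt)
      (fun x _ => (hd x).differentiableAt.differentiableWithinAt) fun x hx => ?_
    rw [interior_Ici] at hx
    rw [(hd x).deriv]
    have hx : 0 < x := hx
    have : Real.exp (-x) ≤ 1 := Real.exp_le_one_iff.2 (by linarith)
    have : 0 ≤ 1 - Real.exp (-x) := by linarith
    positivity
  have := hm (Set.mem_Ici.2 le_rfl) (Set.mem_Ici.2 ht) ht
  simp at this
  linarith

/-- Concavity of `surprisalSq` on the unit interval, as a tangent inequality. -/
lemma surprisalSq_le_tangent {x y : ℝ} (hx0 : 0 ≤ x) (hx1 : x ≤ 1) (hy0 : 0 < y) (hy1 : y ≤ 1) :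
    surprisalSq x ≤ surprisalSq y + (Real.log y ^ 2 - 1) * (x - y) := by
  have hl : Real.log y ≤ 0 := Real.log_nonpos hy0.le hy1
  unfold surprisalSq
  rcases hx0.eq_or_lt with rfl | hx0
  · nlinarith
  obtain ⟨t, ht⟩ : ∃ t, t = Real.log x - Real.log y := ⟨_, rfl⟩
  have hlx : Real.log x = Real.log y + t := by linarith
  have hxy : x = y * Real.exp t := by
    rw [ht, Real.exp_sub, Real.exp_log hx0, Real.exp_log hy0]; field_simp
  have hlx0 : Real.log y + t ≤ 0 := hlx ▸ Real.log_nonpos hx0.le hx1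
  rw [hlx, hxy]
  generalize Real.log y = l at *
  -- The tangent inequality divided by `y`, with `x = y exp t` and `l = ln y`. The coefficient of
  -- `-2 l` is nonpositive. For `t ≥ 0` the worst case is `l = -t`, that is `x = 1`, which reduces
  -- to `two_sub_sq_le`.
  have key : -2 * l * (Real.exp t * (1 - t) - 1) + Real.exp t * (2 - 2 * t + t ^ 2) - 2 ≤ 0 := by
    have he : Real.exp t * Real.exp (-t) = 1 := by rw [← Real.exp_add]; simp
    have hp := Real.exp_pos t
    have h1 : Real.exp t * (1 - t) - 1 ≤ 0 := by
      have := Real.add_one_le_exp (-t)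
      nlinarith
    rcases le_total t 0 with h | h
    · have := Real.quadratic_le_exp_of_nonneg (neg_nonneg.2 h)
      have h2 : Real.exp t * (2 - 2 * t + t ^ 2) - 2 ≤ 0 := by nlinarith
      nlinarith
    · have := two_sub_sq_le h
      have h2 : Real.exp t * (2 - t ^ 2) ≤ 2 + 2 * t := by
        calc Real.exp t * (2 - t ^ 2) ≤ Real.exp t * ((2 + 2 * t) * Real.exp (-t)) := by gcongr
          _ = (2 + 2 * t) * (Real.exp t * Real.exp (-t)) := by ring
          _ = 2 + 2 * t := by rw [he, mul_one]
      nlinarith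
  nlinarith [mul_nonpos_of_nonneg_of_nonpos hy0.le key]

lemma negMulLog_le_tangent {x y : ℝ} (hx0 : 0 ≤ x) (hy0 : 0 < y) :
    Real.negMulLog x ≤ Real.negMulLog y + (-Real.log y - 1) * (x - y) := by
  unfold Real.negMulLog
  rcases hx0.eq_or_lt with rfl | hx0
  · nlinarith
  have h := Real.log_le_sub_one_of_pos (div_pos hy0 hx0)
  rw [Real.log_div hy0.ne' hx0.ne'] at h
  have := mul_le_mul_of_nonneg_left h hx0.le
  have e : x * (y / x - 1) = y - x := by field_simp
  rw [e] at this
  nlinarith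

/-! ### Doubly stochastic maps -/

/-- Sums of a concave function vanishing at `0` do not decrease under doubly stochastic maps. -/
lemma sum_le_sum_of_doublyStochastic {m : Type*} [Fintype m] {g : ℝ → ℝ} (g0 : g 0 = 0)
    (hg : ∀ y, 0 < y → y ≤ 1 → ∃ c, ∀ x, 0 ≤ x → x ≤ 1 → g x ≤ g y + c * (x - y))
    (D : m → m → ℝ) (hD : ∀ x y, 0 ≤ D x y) (hr : ∀ x, ∑ y, D x y = 1) (hc : ∀ y, ∑ x, D x y = 1)
    (l : m → ℝ) (l0 : ∀ y, 0 ≤ l y) (l1 : ∀ y, l y ≤ 1) :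
    ∑ y, g (l y) ≤ ∑ x, g (∑ y, D x y * l y) := by
  have e : ∑ y, g (l y) = ∑ x, ∑ y, D x y * g (l y) := by
    rw [Finset.sum_comm]
    simp [← Finset.sum_mul, hc]
  rw [e]
  refine Finset.sum_le_sum fun x _ => ?_
  have hnn : ∀ y ∈ Finset.univ, 0 ≤ D x y * l y := fun y _ => mul_nonneg (hD x y) (l0 y)
  -- Tangents are assumed only at positive points. A zero mean forces every term `D x y * l y` to
  -- vanish.
  rcases (Finset.sum_nonneg hnn).eq_or_lt with h | h
  · rw [← h, g0]
    refine (Finset.sum_eq_zero fun y hy => ?_).le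
    rcases mul_eq_zero.1 ((Finset.sum_eq_zero_iff_of_nonneg hnn).1 h.symm y hy) with h | h
    · simp [h]
    · simp [h, g0]
  · have h1 : ∑ y, D x y * l y ≤ 1 := by
      rw [← hr x]
      exact Finset.sum_le_sum fun y _ => mul_le_of_le_one_right (hD x y) (l1 y)
    obtain ⟨c, hc⟩ := hg _ h h1
    have e2 : ∑ y, D x y * (l y - ∑ y, D x y * l y) = 0 := by
      simp only [mul_sub, Finset.sum_sub_distrib, ← Finset.sum_mul, hr, one_mul, sub_self]
    calc ∑ y, D x y * g (l y)
        ≤ ∑ y, D x y * (g (∑ y, D x y * l y) + c * (l y - ∑ y, D x y * l y)) :=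
          Finset.sum_le_sum fun y _ => mul_le_mul_of_nonneg_left (hc _ (l0 y) (l1 y)) (hD x y)
      _ = (∑ y, D x y) * g (∑ y, D x y * l y)
          + c * ∑ y, D x y * (l y - ∑ y, D x y * l y) := by
          simp only [mul_add, Finset.sum_add_distrib, Finset.sum_mul, Finset.mul_sum,
            mul_left_comm c]
      _ = _ := by rw [hr, e2]; ring

/-! ### Moment and Hellinger bounds for probability vectors -/

/-- Comes from `e u ≤ exp u` at `u = t / 4` and `2.7 < e`; the constant exceeds `(4 / 2.7) ^ 4`. -/
lemma pow_four_le_exp {t : ℝ} (ht : 0 ≤ t) : t ^ 4 ≤ 4.83 * Real.exp t := by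
  have h := Real.add_one_le_exp (t / 4 - 1)
  have e : Real.exp (t / 4) = Real.exp 1 * Real.exp (t / 4 - 1) := by
    rw [← Real.exp_add]; ring_nf
  have h1 : 2.7 * (t / 4) ≤ Real.exp (t / 4) := by
    rw [e]
    have := Real.exp_one_gt_d9
    gcongr <;> linarith
  have h2 := pow_le_pow_left₀ (by positivity) h1 4
  rw [← Real.exp_nat_mul] at h2
  have e2 : ((4 : ℕ) : ℝ) * (t / 4) = t := by push_cast; ring
  rw [e2] at h2
  have : t ^ 4 = (2.7 * (t / 4)) ^ 4 * (4 / 2.7) ^ 4 := by ring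
  rw [this]
  have := Real.exp_pos t
  nlinarith

/-- Fourth moment of the surprisal of a probability vector. -/
lemma sum_mul_log_pow_four_le {n : Type*} [Fintype n] (a : n → ℝ) (a0 : ∀ i, 0 ≤ a i)
    (a1 : ∑ i, a i = 1) :
    ∑ i, a i * Real.log (a i) ^ 4 ≤ 8 * Real.log (Fintype.card n) ^ 4 + 38.64 := by
  have hne : Nonempty n := by
    by_contra h
    rw [not_nonempty_iff] at h
    simp at a1
  have hn : (0 : ℝ) < Fintype.card n := by exact_mod_cast Fintype.card_pos
  have hl : 0 ≤ Real.log (Fintype.card n) :=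
    Real.log_nonneg (by exact_mod_cast Fintype.card_pos)
  have key : ∀ i, a i * Real.log (a i) ^ 4 ≤
      8 * Real.log (Fintype.card n) ^ 4 * a i + 38.64 / Fintype.card n := by
    intro i
    rcases (a0 i).eq_or_lt with h | h
    · simp [← h]; positivity
    have hi1 : a i ≤ 1 := a1 ▸ Finset.single_le_sum (fun j _ => a0 j) (Finset.mem_univ i)
    have hlog := Real.log_nonpos h.le hi1
    have ha : a i = Real.exp (Real.log (a i)) := (Real.exp_log h).symm
    have hN : (Fintype.card n : ℝ) = Real.exp (Real.log (Fintype.card n)) := (Real.exp_log hn).symm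
    generalize hL : Real.log (Fintype.card n) = L at *
    generalize hA : Real.log (a i) = A at *
    -- Beyond `L = ln n`, the excess `u = -A - L` satisfies `a exp u = 1 / n`, so each index costs
    -- at most `8 * 4.83 / n = 38.64 / n`.
    rcases le_total (-A) L with h1 | h1
    · have : A ^ 4 ≤ L ^ 4 := by
        rw [← Even.neg_pow (by decide) A]
        exact pow_le_pow_left₀ (by linarith) h1 4
      have h3 : 0 ≤ L ^ 4 * a i := by positivity
      have h4 : (0 : ℝ) ≤ 38.64 / Fintype.card n := by positivity
      nlinarith
    · have h2 := pow_four_le_exp (sub_nonneg.2 h1)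
      have h3 : A ^ 4 ≤ 8 * L ^ 4 + 8 * (-A - L) ^ 4 := by
        have := add_pow_le hl (sub_nonneg.2 h1) 4
        have e : L + (-A - L) = -A := by ring
        rw [e, Even.neg_pow (by decide) A] at this
        norm_num at this
        linarith
      have h5 : a i * Real.exp (-A - L) = 1 / Fintype.card n := by
        rw [ha, hN, ← Real.exp_add, one_div, ← Real.exp_neg]; ring_nf
      calc a i * A ^ 4 ≤ a i * (8 * L ^ 4 + 8 * (4.83 * Real.exp (-A - L))) := by
            gcongr; linarith
        _ = 8 * L ^ 4 * a i + 38.64 * (a i * Real.exp (-A - L)) := by ring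
        _ = _ := by rw [h5]; ring
  refine (Finset.sum_le_sum fun i _ => key i).trans (le_of_eq ?_)
  rw [Finset.sum_add_distrib, ← Finset.mul_sum, a1]
  simp
  field_simp

/-- The squared Hellinger distance is at most the relative entropy. -/
lemma sum_sqrt_sub_sq_le {m : Type*} [Fintype m] (p q : m → ℝ) (p0 : ∀ x, 0 ≤ p x)
    (q0 : ∀ x, 0 ≤ q x) (hpq : ∀ x, q x = 0 → p x = 0) (h : ∑ x, q x = ∑ x, p x) :
    ∑ x, (√(p x) - √(q x)) ^ 2 ≤ ∑ x, p x * (Real.log (p x) - Real.log (q x)) := by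
  have key : ∀ x, (√(p x) - √(q x)) ^ 2 ≤
      p x * (Real.log (p x) - Real.log (q x)) + (q x - p x) := by
    intro x
    have hp := Real.sq_sqrt (p0 x)
    have hq := Real.sq_sqrt (q0 x)
    rcases (p0 x).eq_or_lt with h | h
    · simp [← h, q0 x]
    have hq' : 0 < q x := (q0 x).lt_of_ne' fun h' => h.ne' (hpq x h')
    have sp := Real.sqrt_pos.2 h
    have sq := Real.sqrt_pos.2 hq'
    -- Using `ln z ≤ z - 1` at `z = √(q / p)`, rather than at `q / p`, produces the cross term `√(p
    -- q)`.
    have hl := Real.log_le_sub_one_of_pos (div_pos sq sp)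
    rw [Real.log_div sq.ne' sp.ne', Real.log_sqrt (q0 x), Real.log_sqrt (p0 x)] at hl
    have := mul_le_mul_of_nonneg_left hl (p0 x)
    have e : p x * (√(q x) / √(p x) - 1) = √(p x) * √(q x) - p x := by
      nth_rw 1 [← hp]; field_simp; rw [mul_sub, ← pow_two, hp]
    rw [e] at this
    nlinarith
  refine (Finset.sum_le_sum fun x _ => key x).trans (le_of_eq ?_)
  rw [Finset.sum_add_distrib, Finset.sum_sub_distrib, h]
  ring


/-! ### Joint distributions against the product of their marginals -/

lemma sum_prod_eq_of_marginals {s e : Type*} [Fintype s] [Fintype e] {p : s × e → ℝ} {a : s → ℝ}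
    {b : e → ℝ} (ha : ∀ i, ∑ j, p (i, j) = a i) (hb : ∀ j, ∑ i, p (i, j) = b j)
    (F : s → ℝ) (G : e → ℝ) :
    ∑ x, p x * (F x.1 + G x.2) = ∑ i, a i * F i + ∑ j, b j * G j := by
  simp only [mul_add, Finset.sum_add_distrib]
  congr 1
  · rw [Fintype.sum_prod_type]
    simp only [← Finset.sum_mul, ha]
  · rw [Fintype.sum_prod_type_right]
    simp only [← Finset.sum_mul, hb]

/-- Turns the moment bounds into the bracket of `corrConst`, with `x`, `y` the logarithms of the
dimensions. Both being at least `ln 2` leaves room to absorb the additive constants. -/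
lemma log_moment_le {x y E₁ E₂ : ℝ} (hx : Real.log 2 ≤ x) (hy : Real.log 2 ≤ y)
    (h₁ : E₁ ≤ 8 * x ^ 4 + 38.64) (h₂ : E₂ ≤ 8 * y ^ 4 + 38.64) :
    4 * (E₁ + E₂) ≤ (12 * Real.log 2 ^ 2 + 9 * (x + y) ^ 2) ^ 2 := by
  have h2 := Real.log_two_gt_d9
  have hx0 : 0.69 ≤ x := by linarith
  have hy0 : 0.69 ≤ y := by linarith
  have hc : 5.7 ≤ 12 * Real.log 2 ^ 2 := by nlinarith
  have hL : 1.9 ≤ (x + y) ^ 2 := by nlinarith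
  have h4 : x ^ 4 + y ^ 4 ≤ ((x + y) ^ 2) ^ 2 := by
    have e : ((x + y) ^ 2) ^ 2 = x ^ 4 + y ^ 4 + x * y * (4 * x ^ 2 + 6 * (x * y) + 4 * y ^ 2) := by
      ring
    rw [e]
    have : 0 ≤ x * y * (4 * x ^ 2 + 6 * (x * y) + 4 * y ^ 2) := by positivity
    linarith
  have h5 : (5.7 + 9 * (x + y) ^ 2) ^ 2 ≤ (12 * Real.log 2 ^ 2 + 9 * (x + y) ^ 2) ^ 2 := by
    gcongr
  nlinarith

/-- The covariance of the surprisals of the marginals of a joint distribution `p` is controlled by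
the mutual information of `p`. -/
lemma sum_sub_mul_log_mul_log_le {s e : Type*} [Fintype s] [Fintype e] (p : s × e → ℝ) (a : s → ℝ)
    (b : e → ℝ) (p0 : ∀ x, 0 ≤ p x) (ha : ∀ i, ∑ j, p (i, j) = a i)
    (hb : ∀ j, ∑ i, p (i, j) = b j) (a1 : ∑ i, a i = 1) (b1 : ∑ j, b j = 1) (I : ℝ)
    (hI : ∑ x, p x * (Real.log (p x) - Real.log (a x.1 * b x.2)) ≤ I) :
    2 * ∑ x, (p x - a x.1 * b x.2) * (Real.log (a x.1) * Real.log (b x.2)) ≤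
      corrConst (Fintype.card s * Fintype.card e) * corrFun (I / Real.log 2) := by
  have a0 : ∀ i, 0 ≤ a i := fun i => ha i ▸ Finset.sum_nonneg fun j _ => p0 _
  have b0 : ∀ i, 0 ≤ b i := fun i => hb i ▸ Finset.sum_nonneg fun j _ => p0 _
  have q0 : ∀ x : s × e, 0 ≤ a x.1 * b x.2 := fun x => mul_nonneg (a0 _) (b0 _)
  have qa : ∀ i, ∑ j, (fun x : s × e => a x.1 * b x.2) (i, j) = a i := fun i => by
    simp [← Finset.mul_sum, b1]
  have qb : ∀ j, ∑ i, (fun x : s × e => a x.1 * b x.2) (i, j) = b j := fun j => by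
    simp [← Finset.sum_mul, a1]
  have hpq : ∀ x : s × e, a x.1 * b x.2 = 0 → p x = 0 := by
    intro x hx
    refine le_antisymm ?_ (p0 x)
    rcases mul_eq_zero.1 hx with h | h
    · rw [← h, ← ha]
      exact Finset.single_le_sum (f := fun j => p (x.1, j)) (fun j _ => p0 _) (Finset.mem_univ x.2)
    · rw [← h, ← hb]
      exact Finset.single_le_sum (f := fun j => p (j, x.2)) (fun j _ => p0 _) (Finset.mem_univ x.1)
  have hsum : ∑ x : s × e, a x.1 * b x.2 = ∑ x, p x := by
    rw [Fintype.sum_prod_type, Fintype.sum_prod_type]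
    exact Finset.sum_congr rfl fun i _ => (qa i).trans (ha i).symm
  have hH := (sum_sqrt_sub_sq_le p (fun x => a x.1 * b x.2) p0 q0 hpq hsum).trans hI
  have hI0 : 0 ≤ I := (Finset.sum_nonneg fun x _ => sq_nonneg _).trans hH
  have hlog2 : 0 < Real.log 2 := Real.log_pos one_lt_two
  have hc0 : 0 ≤ corrConst (Fintype.card s * Fintype.card e) := by
    unfold corrConst; positivity
  -- Only the square-root branch of `corrFun` is needed.
  have hf : √(I / Real.log 2) ≤ corrFun (I / Real.log 2) := by
    rw [Real.sqrt_eq_rpow]; exact le_max_right _ _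
  refine le_trans ?_ (mul_le_mul_of_nonneg_left hf hc0)
  have ne_s : Nonempty s := by
    by_contra h; rw [not_nonempty_iff] at h; simp at a1
  have ne_e : Nonempty e := by
    by_contra h; rw [not_nonempty_iff] at h; simp at b1
  -- A one-dimensional factor has zero surprisal, hence no covariance; otherwise `log_moment_le`
  -- applies.
  rcases Nat.lt_or_ge (Fintype.card s) 2 with hs | hs
  · have : Subsingleton s := Fintype.card_le_one_iff_subsingleton.1 (by omega)
    have : ∀ i, a i = 1 := fun i => by rw [← a1, Fintype.sum_subsingleton _ i]
    simp only [this, Real.log_one, zero_mul, mul_zero, Finset.sum_const_zero]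
    positivity
  rcases Nat.lt_or_ge (Fintype.card e) 2 with he | he
  · have : Subsingleton e := Fintype.card_le_one_iff_subsingleton.1 (by omega)
    have : ∀ i, b i = 1 := fun i => by rw [← b1, Fintype.sum_subsingleton _ i]
    simp only [this, Real.log_one, mul_zero, Finset.sum_const_zero]
    positivity
  have hs' : Real.log 2 ≤ Real.log (Fintype.card s) :=
    Real.log_le_log (by norm_num) (by exact_mod_cast hs)
  have he' : Real.log 2 ≤ Real.log (Fintype.card e) :=
    Real.log_le_log (by norm_num) (by exact_mod_cast he)
  have hm := log_moment_le hs' he' (sum_mul_log_pow_four_le a a0 a1)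
    (sum_mul_log_pow_four_le b b0 b1)
  rw [← Real.log_mul (by positivity) (by positivity), ← Nat.cast_mul] at hm
  -- Cauchy-Schwarz for `p - q = (√p - √q)(√p + √q)`: the first factor gives the Hellinger distance,
  -- the second the fourth moments.
  have hcs := Finset.sum_mul_sq_le_sq_mul_sq Finset.univ (fun x => √(p x) - √(a x.1 * b x.2))
    (fun x => (√(p x) + √(a x.1 * b x.2)) * (Real.log (a x.1) * Real.log (b x.2)))
  have e1 : ∑ x, (√(p x) - √(a x.1 * b x.2)) *
      ((√(p x) + √(a x.1 * b x.2)) * (Real.log (a x.1) * Real.log (b x.2))) =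
      ∑ x, (p x - a x.1 * b x.2) * (Real.log (a x.1) * Real.log (b x.2)) := by
    refine Finset.sum_congr rfl fun x _ => ?_
    linear_combination (Real.log (a x.1) * Real.log (b x.2)) *
      (Real.sq_sqrt (p0 x) - Real.sq_sqrt (q0 x))
  have e2 : ∑ x, ((√(p x) + √(a x.1 * b x.2)) * (Real.log (a x.1) * Real.log (b x.2))) ^ 2 ≤
      2 * (∑ i, a i * Real.log (a i) ^ 4 + ∑ j, b j * Real.log (b j) ^ 4) := by
    have hp4 := sum_prod_eq_of_marginals ha hb (fun i => Real.log (a i) ^ 4)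
      (fun j => Real.log (b j) ^ 4)
    have hq4 := sum_prod_eq_of_marginals (p := fun x : s × e => a x.1 * b x.2) qa qb
      (fun i => Real.log (a i) ^ 4) (fun j => Real.log (b j) ^ 4)
    rw [two_mul]
    nth_rw 1 [← hp4]
    rw [← hq4, ← Finset.sum_add_distrib]
    refine Finset.sum_le_sum fun x _ => ?_
    have h1 : (√(p x) + √(a x.1 * b x.2)) ^ 2 ≤ 2 * (p x + a x.1 * b x.2) := by
      have := Real.sq_sqrt (p0 x)
      have := Real.sq_sqrt (q0 x)
      nlinarith [sq_nonneg (√(p x) - √(a x.1 * b x.2))]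
    have h2 : 2 * (Real.log (a x.1) * Real.log (b x.2)) ^ 2 ≤
        Real.log (a x.1) ^ 4 + Real.log (b x.2) ^ 4 := by
      nlinarith [sq_nonneg (Real.log (a x.1) ^ 2 - Real.log (b x.2) ^ 2)]
    rw [mul_pow]
    calc _ ≤ 2 * (p x + a x.1 * b x.2) * (Real.log (a x.1) * Real.log (b x.2)) ^ 2 := by gcongr
      _ = (p x + a x.1 * b x.2) * (2 * (Real.log (a x.1) * Real.log (b x.2)) ^ 2) := by ring
      _ ≤ (p x + a x.1 * b x.2) * (Real.log (a x.1) ^ 4 + Real.log (b x.2) ^ 4) :=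
          mul_le_mul_of_nonneg_left h2 (add_nonneg (p0 x) (q0 x))
      _ = _ := by ring
  rw [e1] at hcs
  refine abs_le_of_sq_le_sq' ?_ (by positivity) |>.2
  rw [mul_pow, mul_pow, Real.sq_sqrt (by positivity), corrConst, mul_pow,
    Real.sq_sqrt (by positivity)]
  have e3 : ∀ c : ℝ, 2 * Real.log 2 * c * (I / Real.log 2) = 2 * I * c := fun c => by field_simp
  rw [e3]
  have := hcs.trans (mul_le_mul hH e2 (Finset.sum_nonneg fun x _ => sq_nonneg _) hI0)
  have := mul_le_mul_of_nonneg_left hm (by positivity : 0 ≤ 2 * I)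
  linarith

/-- Surprisals of a product distribution are sums of independent variables, so means and variances
add; the first two brackets are those variances. -/
lemma sum_surprisalSq_mul {s e : Type*} [Fintype s] [Fintype e] (a : s → ℝ) (b : e → ℝ)
    (a1 : ∑ i, a i = 1) (b1 : ∑ j, b j = 1) :
    ∑ x : s × e, surprisalSq (a x.1 * b x.2) =
      (∑ i, a i * Real.log (a i) ^ 2 - (∑ i, Real.negMulLog (a i)) ^ 2) +
      (∑ j, b j * Real.log (b j) ^ 2 - (∑ j, Real.negMulLog (b j)) ^ 2) +
      (∑ i, Real.negMulLog (a i) + ∑ j, Real.negMulLog (b j) + 1) ^ 2 := by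
  have h : ∀ i j, surprisalSq (a i * b j) = a i * b j + 2 * (Real.negMulLog (a i) * b j) +
      2 * (a i * Real.negMulLog (b j)) + a i * Real.log (a i) ^ 2 * b j +
      a i * (b j * Real.log (b j) ^ 2) + 2 * (Real.negMulLog (a i) * Real.negMulLog (b j)) := by
    intro i j
    unfold surprisalSq Real.negMulLog
    rcases eq_or_ne (a i) 0 with h | h
    · simp [h]
    rcases eq_or_ne (b j) 0 with h' | h'
    · simp [h']
    rw [Real.log_mul h h']
    ring
  rw [Fintype.sum_prod_type]
  simp only [h, Finset.sum_add_distrib, ← Finset.mul_sum, ← Finset.sum_mul, a1, b1]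
  ring

/-- The product of the marginals of `p` has larger total `surprisalSq`, up to the correlation
term. -/
lemma sum_surprisalSq_le_add {s e : Type*} [Fintype s] [Fintype e] (p : s × e → ℝ) (a : s → ℝ)
    (b : e → ℝ) (p0 : ∀ x, 0 ≤ p x) (ha : ∀ i, ∑ j, p (i, j) = a i)
    (hb : ∀ j, ∑ i, p (i, j) = b j) (a1 : ∑ i, a i = 1) (b1 : ∑ j, b j = 1) (I : ℝ)
    (hI : ∑ x, p x * (Real.log (p x) - Real.log (a x.1 * b x.2)) ≤ I) :
    ∑ x, surprisalSq (p x) ≤ ∑ x : s × e, surprisalSq (a x.1 * b x.2) +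
      corrConst (Fintype.card s * Fintype.card e) * corrFun (I / Real.log 2) := by
  have hcov := sum_sub_mul_log_mul_log_le p a b p0 ha hb a1 b1 I hI
  have a0 : ∀ i, 0 ≤ a i := fun i => ha i ▸ Finset.sum_nonneg fun j _ => p0 _
  have b0 : ∀ i, 0 ≤ b i := fun i => hb i ▸ Finset.sum_nonneg fun j _ => p0 _
  have a1' : ∀ i, a i ≤ 1 := fun i => a1 ▸ Finset.single_le_sum (fun j _ => a0 j) (Finset.mem_univ i)
  have b1' : ∀ i, b i ≤ 1 := fun i => b1 ▸ Finset.single_le_sum (fun j _ => b0 j) (Finset.mem_univ i)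
  have pa : ∀ x, p x ≤ a x.1 := fun x => by
    rw [← ha]
    exact Finset.single_le_sum (f := fun j => p (x.1, j)) (fun j _ => p0 _) (Finset.mem_univ x.2)
  have pb : ∀ x, p x ≤ b x.2 := fun x => by
    rw [← hb]
    exact Finset.single_le_sum (f := fun j => p (j, x.2)) (fun j _ => p0 _) (Finset.mem_univ x.1)
  have qa : ∀ i, ∑ j, (fun x : s × e => a x.1 * b x.2) (i, j) = a i := fun i => by
    simp [← Finset.mul_sum, b1]
  have qb : ∀ j, ∑ i, (fun x : s × e => a x.1 * b x.2) (i, j) = b j := fun j => by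
    simp [← Finset.sum_mul, a1]
  have hp4 := sum_prod_eq_of_marginals ha hb (fun i => Real.log (a i) ^ 2 - 1)
    (fun j => Real.log (b j) ^ 2)
  have hq4 := sum_prod_eq_of_marginals (p := fun x : s × e => a x.1 * b x.2) qa qb
    (fun i => Real.log (a i) ^ 2 - 1) (fun j => Real.log (b j) ^ 2)
  have key : ∀ x : s × e, surprisalSq (p x) ≤ surprisalSq (a x.1 * b x.2) +
      (p x * ((Real.log (a x.1) ^ 2 - 1) + Real.log (b x.2) ^ 2) -
        a x.1 * b x.2 * ((Real.log (a x.1) ^ 2 - 1) + Real.log (b x.2) ^ 2)) +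
      2 * ((p x - a x.1 * b x.2) * (Real.log (a x.1) * Real.log (b x.2))) := by
    intro x
    rcases (a0 x.1).eq_or_lt with h | h
    · have : p x = 0 := le_antisymm (h ▸ pa x) (p0 x)
      simp [← h, this]
    rcases (b0 x.2).eq_or_lt with h' | h'
    · have : p x = 0 := le_antisymm (h' ▸ pb x) (p0 x)
      simp [← h', this]
    have := surprisalSq_le_tangent (p0 x) ((pa x).trans (a1' _)) (mul_pos h h')
      (mul_le_one₀ (a1' _) (b0 _) (b1' _))
    rw [Real.log_mul h.ne' h'.ne'] at this
    linarith
  have := Finset.sum_le_sum fun x (_ : x ∈ Finset.univ) => key x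
  rw [Finset.sum_add_distrib, Finset.sum_add_distrib, Finset.sum_sub_distrib, hp4, hq4,
    ← Finset.mul_sum] at this
  linarith


/-! ### Spectral calculus in a chosen eigenbasis -/

/-- The Hermitian matrix with eigenvalues `a` and the columns of `U` as eigenvectors. -/
def conjDiag {n : Type*} [Fintype n] [DecidableEq n] (U : Matrix n n ℂ) (a : n → ℝ) :
    Matrix n n ℂ :=
  U * Matrix.diagonal (fun i => (a i : ℂ)) * Uᴴ

lemma le_one_of_sum_eq_one {m : Type*} [Fintype m] {c : m → ℝ} (c0 : ∀ i, 0 ≤ c i)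
    (c1 : ∑ i, c i = 1) (i : m) : c i ≤ 1 :=
  c1 ▸ Finset.single_le_sum (fun j _ => c0 j) (Finset.mem_univ i)

section
variable {n : Type*} [Fintype n] [DecidableEq n]

lemma isHermitian_conjDiag (U : Matrix n n ℂ) (a : n → ℝ) : (conjDiag U a).IsHermitian := by
  refine Matrix.isHermitian_mul_mul_conjTranspose U (Matrix.isHermitian_diagonal_of_self_adjoint _ ?_)
  ext i
  simp

lemma eq_conjDiag_of_isHermitian {ρ : Matrix n n ℂ} (h : ρ.IsHermitian) :
    ρ = conjDiag (h.eigenvectorUnitary : Matrix n n ℂ) h.eigenvalues := by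
  conv_lhs => rw [h.spectral_theorem]
  rfl

lemma conjDiag_mul {U : Matrix n n ℂ} (hU : U ∈ unitary (Matrix n n ℂ)) (a b : n → ℝ) :
    conjDiag U a * conjDiag U b = conjDiag U (fun i => a i * b i) := by
  have h : Uᴴ * U = 1 := hU.1
  calc _ = U * Matrix.diagonal (fun i => (a i : ℂ)) * (Uᴴ * U) *
        Matrix.diagonal (fun i => (b i : ℂ)) * Uᴴ := by simp only [conjDiag, Matrix.mul_assoc]
    _ = _ := by
      rw [h, Matrix.mul_one, Matrix.mul_assoc U, Matrix.diagonal_mul_diagonal, conjDiag]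
      simp

lemma trace_mul_conjDiag (X U : Matrix n n ℂ) (a : n → ℝ) :
    (X * conjDiag U a).trace.re = ∑ i, ((Uᴴ * X * U) i i).re * a i := by
  have : (X * conjDiag U a).trace =
      (Uᴴ * X * U * Matrix.diagonal (fun i => (a i : ℂ))).trace := by
    rw [conjDiag, ← Matrix.mul_assoc, Matrix.trace_mul_comm]
    simp only [Matrix.mul_assoc]
  rw [this, Matrix.trace, Complex.re_sum]
  simp [Matrix.mul_diagonal]

lemma trace_conjDiag {U : Matrix n n ℂ} (hU : U ∈ unitary (Matrix n n ℂ)) (a : n → ℝ) :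
    (conjDiag U a).trace = ((∑ i, a i : ℝ) : ℂ) := by
  have h : Uᴴ * U = 1 := hU.1
  rw [conjDiag, Matrix.trace_mul_comm, ← Matrix.mul_assoc, h, Matrix.one_mul, Matrix.trace_diagonal]
  simp

lemma conjTranspose_mul_conjDiag_mul {U : Matrix n n ℂ} (hU : U ∈ unitary (Matrix n n ℂ))
    (a : n → ℝ) : Uᴴ * conjDiag U a * U = Matrix.diagonal (fun i => (a i : ℂ)) := by
  have h : Uᴴ * U = 1 := hU.1
  calc _ = (Uᴴ * U) * Matrix.diagonal (fun i => (a i : ℂ)) * (Uᴴ * U) := by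
        simp only [conjDiag, Matrix.mul_assoc]
    _ = _ := by rw [h, Matrix.one_mul, Matrix.mul_one]

/-- Frees the functional calculus from the eigenbasis `W` chosen by the spectral theorem. `Wᴴ * U`
intertwines the two diagonals, so its nonzero entries join equal eigenvalues, and it intertwines
their images under `f` too. -/
lemma cfc_conjDiag {U : Matrix n n ℂ} (hU : U ∈ unitary (Matrix n n ℂ)) (a : n → ℝ)
    (f : ℝ → ℝ) : cfc f (conjDiag U a) = conjDiag U (fun i => f (a i)) := by
  have hM := isHermitian_conjDiag U a
  have hrM := eq_conjDiag_of_isHermitian hM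
  have hW := hM.eigenvectorUnitary.2
  rw [hM.cfc_eq]
  change conjDiag (hM.eigenvectorUnitary : Matrix n n ℂ) (fun i => f (hM.eigenvalues i)) = _
  generalize (hM.eigenvectorUnitary : Matrix n n ℂ) = W at *
  generalize hM.eigenvalues = r at *
  have hW1 : Wᴴ * W = 1 := hW.1
  have hW2 : W * Wᴴ = 1 := hW.2
  have hU1 : Uᴴ * U = 1 := hU.1
  have hU2 : U * Uᴴ = 1 := hU.2
  have h1 : Matrix.diagonal (fun i => (r i : ℂ)) * (Wᴴ * U) =
      (Wᴴ * U) * Matrix.diagonal (fun i => (a i : ℂ)) := by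
    calc _ = Wᴴ * W * Matrix.diagonal (fun i => (r i : ℂ)) * Wᴴ * U := by
          rw [hW1, Matrix.one_mul, Matrix.mul_assoc]
      _ = Wᴴ * conjDiag W r * U := by simp only [conjDiag, Matrix.mul_assoc]
      _ = Wᴴ * conjDiag U a * U := by rw [← hrM]
      _ = Wᴴ * U * Matrix.diagonal (fun i => (a i : ℂ)) * (Uᴴ * U) := by
          simp only [conjDiag, Matrix.mul_assoc]
      _ = _ := by rw [hU1, Matrix.mul_one]
  have h2 : Matrix.diagonal (fun i => (f (r i) : ℂ)) * (Wᴴ * U) =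
      (Wᴴ * U) * Matrix.diagonal (fun i => (f (a i) : ℂ)) := by
    ext i j
    have := congrFun (congrFun h1 i) j
    rw [Matrix.diagonal_mul, Matrix.mul_diagonal] at this ⊢
    rcases eq_or_ne ((Wᴴ * U) i j) 0 with h | h
    · rw [h]; simp
    · rw [mul_comm] at this
      have := Complex.ofReal_injective (mul_left_cancel₀ h this)
      rw [this, mul_comm]
  calc conjDiag W (fun i => f (r i))
      = W * (Matrix.diagonal (fun i => (f (r i) : ℂ)) * (Wᴴ * U)) * Uᴴ := by
        simp only [conjDiag, Matrix.mul_assoc, hU2, Matrix.mul_one]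
    _ = (W * Wᴴ) * U * Matrix.diagonal (fun i => (f (a i) : ℂ)) * Uᴴ := by
        rw [h2]; simp only [Matrix.mul_assoc]
    _ = _ := by rw [hW2, Matrix.one_mul, conjDiag]

lemma logm_conjDiag {U : Matrix n n ℂ} (hU : U ∈ unitary (Matrix n n ℂ)) (a : n → ℝ) :
    logm (conjDiag U a) = conjDiag U (fun i => Real.log (a i)) :=
  cfc_conjDiag hU a _

lemma entropy_conjDiag {U : Matrix n n ℂ} (hU : U ∈ unitary (Matrix n n ℂ)) (a : n → ℝ) :
    entropy (conjDiag U a) = ∑ i, Real.negMulLog (a i) := by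
  rw [entropy, logm_conjDiag hU, conjDiag_mul hU, trace_conjDiag hU, Complex.ofReal_re,
    ← Finset.sum_neg_distrib]
  simp [Real.negMulLog]

lemma capacity_conjDiag {U : Matrix n n ℂ} (hU : U ∈ unitary (Matrix n n ℂ)) (a : n → ℝ) :
    capacity (conjDiag U a) =
      ∑ i, a i * Real.log (a i) ^ 2 - (∑ i, Real.negMulLog (a i)) ^ 2 := by
  rw [capacity, entropy_conjDiag hU, logm_conjDiag hU, pow_two (conjDiag _ _), conjDiag_mul hU,
    conjDiag_mul hU, trace_conjDiag hU, Complex.ofReal_re]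
  simp only [pow_two]

lemma IsState.exists_eq_conjDiag {ρ : Matrix n n ℂ} (h : IsState ρ) :
    ∃ U ∈ unitary (Matrix n n ℂ), ∃ a : n → ℝ, (∀ i, 0 ≤ a i) ∧ ∑ i, a i = 1 ∧
      ρ = conjDiag U a := by
  have hU := h.1.1.eigenvectorUnitary.2
  refine ⟨_, hU, h.1.1.eigenvalues, h.1.eigenvalues_nonneg, ?_,
    eq_conjDiag_of_isHermitian h.1.1⟩
  have := h.2
  rw [eq_conjDiag_of_isHermitian h.1.1, trace_conjDiag hU] at this
  exact_mod_cast this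

lemma IsState.entropy_nonneg {ρ : Matrix n n ℂ} (h : IsState ρ) : 0 ≤ entropy ρ := by
  obtain ⟨U, hU, a, a0, a1, rfl⟩ := h.exists_eq_conjDiag
  rw [entropy_conjDiag hU]
  exact Finset.sum_nonneg fun i _ => Real.negMulLog_nonneg (a0 i) (le_one_of_sum_eq_one a0 a1 i)

lemma conjDiag_kronecker {s e : Type*} [Fintype s] [DecidableEq s] [Fintype e] [DecidableEq e]
    (U : Matrix s s ℂ) (V : Matrix e e ℂ) (a : s → ℝ) (b : e → ℝ) :
    conjDiag U a ⊗ₖ conjDiag V b = conjDiag (U ⊗ₖ V) (fun x => a x.1 * b x.2) := by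
  simp only [conjDiag, Matrix.mul_kronecker_mul, Matrix.diagonal_kronecker_diagonal,
    Matrix.conjTranspose_kronecker, Complex.ofReal_mul]

/-! ### Channels and their action on spectra -/

lemma IsChannel.posSemidef {Φ : Matrix n n ℂ →ₗ[ℂ] Matrix n n ℂ} (h : IsChannel Φ)
    {X : Matrix n n ℂ} (hX : X.PosSemidef) : (Φ X).PosSemidef := by
  obtain ⟨r, K, -, hK⟩ := h
  rw [hK]
  exact Matrix.posSemidef_sum _ fun i _ => hX.mul_mul_conjTranspose_same (K i)

lemma IsChannel.trace_eq {Φ : Matrix n n ℂ →ₗ[ℂ] Matrix n n ℂ} (h : IsChannel Φ)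
    (X : Matrix n n ℂ) : (Φ X).trace = X.trace := by
  obtain ⟨r, K, h1, hK⟩ := h
  calc (Φ X).trace = ∑ i, ((K i)ᴴ * K i * X).trace := by
        rw [hK, Matrix.trace_sum]
        exact Finset.sum_congr rfl fun i _ => by rw [Matrix.trace_mul_comm, Matrix.mul_assoc]
    _ = _ := by rw [← Matrix.trace_sum, ← Finset.sum_mul, h1, Matrix.one_mul]

/-- Makes a bare measurement a case of `IsUnitalChannel.sum_le_sum`. -/
lemma isUnitalChannel_id : IsUnitalChannel (LinearMap.id : Matrix n n ℂ →ₗ[ℂ] Matrix n n ℂ) :=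
  ⟨⟨1, fun _ => 1, by simp, by simp⟩, rfl⟩

/-- Trace functionals of concave functions do not decrease under unital channels followed by a
measurement in an orthonormal basis. -/
lemma IsUnitalChannel.sum_le_sum {Φ : Matrix n n ℂ →ₗ[ℂ] Matrix n n ℂ} (h : IsUnitalChannel Φ)
    {V W : Matrix n n ℂ} (hV : V ∈ unitary (Matrix n n ℂ)) (hW : W ∈ unitary (Matrix n n ℂ))
    (l : n → ℝ) (l0 : ∀ y, 0 ≤ l y) (l1 : ∀ y, l y ≤ 1) {g : ℝ → ℝ} (g0 : g 0 = 0)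
    (hg : ∀ y, 0 < y → y ≤ 1 → ∃ c, ∀ x, 0 ≤ x → x ≤ 1 → g x ≤ g y + c * (x - y)) :
    ∑ y, g (l y) ≤ ∑ x, g ((Vᴴ * Φ (conjDiag W l) * V) x x).re := by
  have hV1 : Vᴴ * V = 1 := hV.1
  have hV2 : V * Vᴴ = 1 := hV.2
  have hW1 : Wᴴ * W = 1 := hW.1
  have hW2 : W * Wᴴ = 1 := hW.2
  -- The channel read in the input basis `W` and output basis `V`. The diagonals of `Ψ` on matrix
  -- units form the stochastic matrix: unitality gives its row sums, trace preservation its column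
  -- sums.
  let Ψ : Matrix n n ℂ → Matrix n n ℂ := fun X => Vᴴ * Φ (W * X * Wᴴ) * V
  have hsum : ∀ c : n → ℂ, Ψ (Matrix.diagonal c) = ∑ y, c y • Ψ (Matrix.single y y 1) := by
    intro c
    have : Matrix.diagonal c = ∑ y, c y • Matrix.single y y (1 : ℂ) := by
      rw [← Matrix.sum_single_eq_diagonal]; simp
    simp only [Ψ, this, Finset.mul_sum, Finset.sum_mul, map_sum, Matrix.mul_smul, Matrix.smul_mul,
      map_smul]
  have hpos : ∀ y, (Ψ (Matrix.single y y 1)).PosSemidef := by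
    intro y
    have h1 : (Matrix.single y y (1 : ℂ)).PosSemidef := by
      rw [← Matrix.diagonal_single]
      refine Matrix.PosSemidef.diagonal fun i => ?_
      by_cases hi : i = y <;> simp [hi]
    exact (h.1.posSemidef (h1.mul_mul_conjTranspose_same W)).conjTranspose_mul_mul_same V
  have hp : ∀ x, ((Vᴴ * Φ (conjDiag W l) * V) x x).re =
      ∑ y, (Ψ (Matrix.single y y 1) x x).re * l y := by
    intro x
    change (Ψ (Matrix.diagonal _) x x).re = _
    rw [hsum, Matrix.sum_apply, Complex.re_sum]
    simp [mul_comm]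
  simp only [hp]
  refine sum_le_sum_of_doublyStochastic g0 hg _
    (fun x y => (Complex.le_def.1 ((hpos y).diag_nonneg (i := x))).1) (fun x => ?_) (fun y => ?_)
    l l0 l1
  · have e := hsum 1
    have e1 : Ψ (Matrix.diagonal 1) = 1 := by
      simp only [Ψ]
      rw [show Matrix.diagonal (1 : n → ℂ) = 1 from Matrix.diagonal_one, Matrix.mul_one, hW2, h.2,
        Matrix.mul_one, hV1]
    rw [e1] at e
    have := congrArg (fun M : Matrix n n ℂ => (M x x).re) e
    simpa [Matrix.sum_apply] using this.symm
  · have e : (Ψ (Matrix.single y y 1)).trace = 1 := by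
      simp only [Ψ]
      rw [Matrix.trace_mul_comm, ← Matrix.mul_assoc, hV2, Matrix.one_mul, h.1.trace_eq,
        Matrix.trace_mul_comm, ← Matrix.mul_assoc, hW1, Matrix.one_mul]
      simp
    have := congrArg Complex.re e
    rwa [Matrix.trace, Complex.re_sum, Complex.one_re] at this

end

/-! ### Partial traces and product measurements -/

section
variable {s e : Type*}

lemma traceSnd_posSemidef [Fintype e] {X : Matrix (s × e) (s × e) ℂ} (hX : X.PosSemidef) :
    (traceSnd X).PosSemidef := by
  have : traceSnd X = ∑ k, X.submatrix (fun i => (i, k)) (fun i => (i, k)) := by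
    ext i j; simp [traceSnd, Matrix.sum_apply]
  rw [this]
  exact Matrix.posSemidef_sum _ fun k _ => hX.submatrix _

lemma traceFst_posSemidef [Fintype s] {X : Matrix (s × e) (s × e) ℂ} (hX : X.PosSemidef) :
    (traceFst X).PosSemidef := by
  have : traceFst X = ∑ k, X.submatrix (fun i => (k, i)) (fun i => (k, i)) := by
    ext i j; simp [traceFst, Matrix.sum_apply]
  rw [this]
  exact Matrix.posSemidef_sum _ fun k _ => hX.submatrix _

variable [Fintype s] [Fintype e]

lemma trace_traceSnd_mul [DecidableEq e] (X : Matrix (s × e) (s × e) ℂ) (Y : Matrix s s ℂ) :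
    (traceSnd X * Y).trace = (X * (Y ⊗ₖ (1 : Matrix e e ℂ))).trace := by
  simp only [Matrix.trace, Matrix.diag_apply, Matrix.mul_apply, traceSnd, Matrix.of_apply,
    Fintype.sum_prod_type, Matrix.kroneckerMap_apply, Matrix.one_apply, Finset.sum_mul]
  refine Finset.sum_congr rfl fun i _ => ?_
  rw [Finset.sum_comm]
  simp

lemma trace_traceFst_mul [DecidableEq s] (X : Matrix (s × e) (s × e) ℂ) (Y : Matrix e e ℂ) :
    (traceFst X * Y).trace = (X * ((1 : Matrix s s ℂ) ⊗ₖ Y)).trace := by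
  simp only [Matrix.trace, Matrix.diag_apply, Matrix.mul_apply, traceFst, Matrix.of_apply,
    Fintype.sum_prod_type_right, Matrix.kroneckerMap_apply, Matrix.one_apply, Finset.sum_mul]
  refine Finset.sum_congr rfl fun i _ => ?_
  rw [Finset.sum_comm]
  simp

variable [DecidableEq s] [DecidableEq e]

lemma diag_eq_trace {n : Type*} [Fintype n] [DecidableEq n] (U X : Matrix n n ℂ) (i : n) :
    (Uᴴ * X * U) i i = (X * (U * Matrix.single i i 1 * Uᴴ)).trace := by
  rw [← Matrix.mul_assoc, Matrix.trace_mul_comm, ← Matrix.mul_assoc, ← Matrix.mul_assoc]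
  simp [Matrix.trace_mul_single]

/-- The projections onto the columns of `V` resolve the identity, so summing over them leaves the
partial trace. -/
lemma sum_diag_kronecker_snd {U : Matrix s s ℂ} {V : Matrix e e ℂ}
    (hV : V ∈ unitary (Matrix e e ℂ)) (X : Matrix (s × e) (s × e) ℂ) (i : s) :
    ∑ j, ((U ⊗ₖ V)ᴴ * X * (U ⊗ₖ V)) (i, j) (i, j) = (Uᴴ * traceSnd X * U) i i := by
  have hV2 : V * Vᴴ = 1 := hV.2
  have h1 : ∑ j, V * Matrix.single j j 1 * Vᴴ = 1 := by
    rw [← Finset.sum_mul, ← Finset.mul_sum, Matrix.sum_single_eq_diagonal]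
    simpa using hV2
  simp only [diag_eq_trace, trace_traceSnd_mul, ← Matrix.trace_sum, ← Finset.mul_sum, ← h1]
  congr 2
  ext x y
  simp only [Matrix.sum_apply, Matrix.kroneckerMap_apply, Finset.mul_sum]
  refine Finset.sum_congr rfl fun j _ => ?_
  rw [← Matrix.kroneckerMap_apply (· * ·), Matrix.mul_kronecker_mul, Matrix.mul_kronecker_mul,
    Matrix.conjTranspose_kronecker, Matrix.single_kronecker_single, one_mul]

lemma sum_diag_kronecker_fst {U : Matrix s s ℂ} {V : Matrix e e ℂ}
    (hU : U ∈ unitary (Matrix s s ℂ)) (X : Matrix (s × e) (s × e) ℂ) (j : e) :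
    ∑ i, ((U ⊗ₖ V)ᴴ * X * (U ⊗ₖ V)) (i, j) (i, j) = (Vᴴ * traceFst X * V) j j := by
  have hU2 : U * Uᴴ = 1 := hU.2
  have h1 : ∑ j, U * Matrix.single j j 1 * Uᴴ = 1 := by
    rw [← Finset.sum_mul, ← Finset.mul_sum, Matrix.sum_single_eq_diagonal]
    simpa using hU2
  simp only [diag_eq_trace, trace_traceFst_mul, ← Matrix.trace_sum, ← Finset.mul_sum, ← h1]
  congr 2
  ext x y
  simp only [Matrix.sum_apply, Matrix.kroneckerMap_apply, Finset.sum_mul]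
  refine Finset.sum_congr rfl fun j _ => ?_
  rw [← Matrix.kroneckerMap_apply (· * ·), Matrix.mul_kronecker_mul, Matrix.mul_kronecker_mul,
    Matrix.conjTranspose_kronecker, Matrix.single_kronecker_single, one_mul]

lemma isState_traceSnd {ρ : Matrix (s × e) (s × e) ℂ} (h : IsState ρ) : IsState (traceSnd ρ) := by
  refine ⟨traceSnd_posSemidef h.1, ?_⟩
  have := trace_traceSnd_mul ρ (1 : Matrix s s ℂ)
  rwa [Matrix.one_kronecker_one, Matrix.mul_one, Matrix.mul_one, h.2] at this

lemma isState_traceFst {ρ : Matrix (s × e) (s × e) ℂ} (h : IsState ρ) : IsState (traceFst ρ) := by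
  refine ⟨traceFst_posSemidef h.1, ?_⟩
  have := trace_traceFst_mul ρ (1 : Matrix e e ℂ)
  rwa [Matrix.one_kronecker_one, Matrix.mul_one, Matrix.mul_one, h.2] at this

end
end QInfo

/-! ### The main inequality -/

open QInfo in
theorem mainTheorem8 {s e : Type*} [Fintype s] [DecidableEq s] [Fintype e] [DecidableEq e]
    (𝓔 : Matrix s s ℂ →ₗ[ℂ] Matrix s s ℂ) (h𝓔 : QInfo.IsChannel 𝓔)
    (𝓤 : Matrix (s × e) (s × e) ℂ →ₗ[ℂ] Matrix (s × e) (s × e) ℂ)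
    (h𝓤 : QInfo.IsUnitalChannel 𝓤)
    (ρS : Matrix s s ℂ) (hρS : QInfo.IsState ρS)
    (ρE : Matrix e e ℂ) (hρE : QInfo.IsState ρE)
    (hreal : 𝓔 ρS = QInfo.traceSnd (𝓤 (ρS ⊗ₖ ρE)))
    (ρSE' : Matrix (s × e) (s × e) ℂ) (hρSE' : ρSE' = 𝓤 (ρS ⊗ₖ ρE))
    (ρS' : Matrix s s ℂ) (hρS' : ρS' = 𝓔 ρS)
    (ρE' : Matrix e e ℂ) (hρE' : ρE' = QInfo.traceFst ρSE')
    (ΔSS ΔSE ΔCS ΔCE : ℝ)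
    (hΔSS : ΔSS = QInfo.entropy ρS' - QInfo.entropy ρS)
    (hΔSE : ΔSE = QInfo.entropy ρE' - QInfo.entropy ρE)
    (hΔCS : ΔCS = QInfo.capacity ρS' - QInfo.capacity ρS)
    (hΔCE : ΔCE = QInfo.capacity ρE' - QInfo.capacity ρE) :
    ΔSS + ΔSE ≥
      (QInfo.entropy ρS + QInfo.entropy ρE + 1) *
        (Real.sqrt (1 +
          (-ΔCS - ΔCE -
            QInfo.corrConst (Fintype.card s * Fintype.card e) *
              QInfo.corrFun (QInfo.mutualInfo ρSE' / Real.log 2)) /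
            (QInfo.entropy ρS + QInfo.entropy ρE + 1) ^ 2) - 1) := by
  have hst : IsState ρSE' := by
    rw [hρSE']
    refine ⟨h𝓤.1.posSemidef (hρS.1.kronecker hρE.1), ?_⟩
    rw [h𝓤.1.trace_eq, Matrix.trace_kronecker, hρS.2, hρE.2, one_mul]
  have hS' : ρS' = traceSnd ρSE' := by rw [hρS', hreal, hρSE']
  have hsS' : IsState ρS' := hS' ▸ isState_traceSnd hst
  have hsE' : IsState ρE' := hρE' ▸ isState_traceFst hst
  have hmut : mutualInfo ρSE' = relEntropy ρSE' (ρS' ⊗ₖ ρE') := by rw [mutualInfo, hS', hρE']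
  obtain ⟨US, hUS, α, α0, α1, rfl⟩ := hρS.exists_eq_conjDiag
  obtain ⟨UE, hUE, β, β0, β1, rfl⟩ := hρE.exists_eq_conjDiag
  obtain ⟨VS, hVS, a, a0, a1, hVSa⟩ := hsS'.exists_eq_conjDiag
  obtain ⟨VE, hVE, b, b0, b1, hVEb⟩ := hsE'.exists_eq_conjDiag
  obtain ⟨W, hW, r, r0, r1, hWr⟩ := hst.exists_eq_conjDiag
  have hU := Matrix.kronecker_mem_unitary hUS hUE
  have hV := Matrix.kronecker_mem_unitary hVS hVE
  let p : s × e → ℝ := fun x => (((VS ⊗ₖ VE)ᴴ * ρSE' * (VS ⊗ₖ VE)) x x).re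
  have p0 : ∀ x, 0 ≤ p x := fun x =>
    (Complex.le_def.1 ((hst.1.conjTranspose_mul_mul_same (VS ⊗ₖ VE)).diag_nonneg (i := x))).1
  have pa : ∀ i, ∑ j, p (i, j) = a i := fun i => by
    rw [← Complex.re_sum, sum_diag_kronecker_snd hVE, ← hS', hVSa,
      conjTranspose_mul_conjDiag_mul hVS]
    simp
  have pb : ∀ j, ∑ i, p (i, j) = b j := fun j => by
    rw [← Complex.re_sum, sum_diag_kronecker_fst hVS, ← hρE', hVEb,
      conjTranspose_mul_conjDiag_mul hVE]
    simp
  have hM : ∑ x : s × e, surprisalSq (α x.1 * β x.2) ≤ ∑ x, surprisalSq (p x) := by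
    have := h𝓤.sum_le_sum hV hU (fun x : s × e => α x.1 * β x.2)
      (fun x => mul_nonneg (α0 _) (β0 _))
      (fun x => mul_le_one₀ (le_one_of_sum_eq_one α0 α1 _) (β0 _) (le_one_of_sum_eq_one β0 β1 _)) surprisalSq_zero
      (fun y hy0 hy1 => ⟨_, fun x hx0 hx1 => surprisalSq_le_tangent hx0 hx1 hy0 hy1⟩)
    rwa [← conjDiag_kronecker, ← hρSE'] at this
  -- Measuring does not lower entropy: the identity channel, from the eigenbasis `W` to the product
  -- basis.
  have hH : entropy ρSE' ≤ ∑ x, Real.negMulLog (p x) := by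
    have := isUnitalChannel_id.sum_le_sum hV hW r r0 (le_one_of_sum_eq_one r0 r1) Real.negMulLog_zero
      (fun y hy0 _ => ⟨_, fun x hx0 _ => negMulLog_le_tangent hx0 hy0⟩)
    rwa [LinearMap.id_apply, ← hWr, ← entropy_conjDiag hW, ← hWr] at this
  have hI : ∑ x, p x * (Real.log (p x) - Real.log (a x.1 * b x.2)) ≤ mutualInfo ρSE' := by
    rw [hmut, hVSa, hVEb, conjDiag_kronecker, relEntropy, logm_conjDiag hV, Matrix.mul_sub,
      Matrix.trace_sub, Complex.sub_re, trace_mul_conjDiag]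
    simp only [mul_sub, Finset.sum_sub_distrib]
    -- The logarithm of the product of marginals is diagonal in the measured basis, so the second
    -- terms agree and only entropies remain to compare.
    refine sub_le_sub_right ?_ _
    rw [entropy] at hH
    have : ∑ x, Real.negMulLog (p x) = -∑ x, p x * Real.log (p x) := by
      simp [Real.negMulLog]
    linarith
  have hmain := hM.trans (sum_surprisalSq_le_add p a b p0 pa pb a1 b1 _ hI)
  rw [sum_surprisalSq_mul α β α1 β1, sum_surprisalSq_mul a b a1 b1, ← capacity_conjDiag hUS,
    ← capacity_conjDiag hUE, ← capacity_conjDiag hVS, ← capacity_conjDiag hVE,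
    ← entropy_conjDiag hUS, ← entropy_conjDiag hUE, ← entropy_conjDiag hVS,
    ← entropy_conjDiag hVE, ← hVSa, ← hVEb] at hmain
  have := hρS.entropy_nonneg
  have := hρE.entropy_nonneg
  have := hsS'.entropy_nonneg
  have := hsE'.entropy_nonneg
  subst hΔSS hΔSE hΔCS hΔCE
  -- With `T ≥ 0` this also covers a negative radicand, where `√` is `0`.
  have key : ∀ {A T X : ℝ}, 0 < A → 0 ≤ T → A ^ 2 + X ≤ T ^ 2 → A * √(1 + X / A ^ 2) ≤ T := by
    intro A T X hA hT h
    have e : A * √(1 + X / A ^ 2) = √(A ^ 2 + X) := by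
      nth_rw 1 [← Real.sqrt_sq hA.le]
      rw [← Real.sqrt_mul (sq_nonneg A)]
      congr 1
      field_simp
    rw [e]
    exact Real.sqrt_le_iff.2 ⟨hT, h⟩
  have := key (A := entropy (conjDiag US α) + entropy (conjDiag UE β) + 1)
    (T := entropy ρS' + entropy ρE' + 1) (X := -(capacity ρS' - capacity (conjDiag US α)) -
      (capacity ρE' - capacity (conjDiag UE β)) -
      corrConst (Fintype.card s * Fintype.card e) * corrFun (mutualInfo ρSE' / Real.log 2))
    (by linarith) (by linarith) (by linarith)
  linarith
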